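/- For integers $m,n\ge 1$ let $K_{m\times n}$ denote the complete multipartite graph with $m$ parts of size $n$. For $k\ge 3$, a $k$-cycle decomposition of a graph $K$ is a set of $k$-cycles of $K$ whose edge sets partition the edge set of $K$. If the vertex set of $K$ is an additive cyclic group $G$, the decomposition $\mathcal D$ is called cyclic if $C+g\in\mathcal D$ for all $C\in\mathcal D$ and $g\in G$. Two cycle decompositions $\mathcal D,\mathcal D'$ of $K$ are orthogonal if no cycle of $\mathcal D$ shares more than one edge with a cycle of $\mathcal D'$. Theorem. For every prime $p\ge 3$ and every integer $k$ with $3\le k\le p$, the graph $K_{(2k+1)\times p}$ can be realized with vertex set $\mathbb Z_{(2k+1)p}$ in such a way that it has at least $p$ distinct, mutually orthogonal, cyclic $k$-cycle decompositions. -/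

import Mathlib

namespace CycleDecomp

/-- `C` is a `k`-cycle (for `k ≥ 3`) with vertices in `V`. A cycle is recorded by its edges: it is
the simple graph on `V` whose edges are `{f 0, f 1}, {f 1, f 2}, …, {f (k - 1), f 0}` for `k`
pairwise distinct vertices `f 0, …, f (k - 1)`; the vertices not on the cycle are isolated. -/
def IsKCycle {V : Type*} (k : ℕ) (C : SimpleGraph V) : Prop :=
  ∃ f : Fin k → V, Function.Injective f ∧ C = (SimpleGraph.cycleGraph k).map f

/-- `D` is a `k`-cycle decomposition of the graph `K`: a set of `k`-cycles whose edge sets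
partition the edge set of `K`. -/
structure IsKCycleDecomposition {V : Type*} (k : ℕ) (K : SimpleGraph V)
    (D : Set (SimpleGraph V)) : Prop where
  isKCycle : ∀ C ∈ D, IsKCycle k C
  pairwiseDisjoint : D.PairwiseDisjoint SimpleGraph.edgeSet
  iUnion_edgeSet : ⋃ C ∈ D, C.edgeSet = K.edgeSet

/-- The translate `C + g` of a graph `C` on an additive group: every vertex `x` is replaced by
`x + g`. -/
def translate {G : Type*} [AddGroup G] (C : SimpleGraph G) (g : G) : SimpleGraph G :=
  C.map (fun x => x + g)

/-- A set `D` of graphs on the additive group `G` is `G`-regular if it contains `C + g` for all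
`C ∈ D` and `g ∈ G`. -/
def IsRegular {G : Type*} [AddGroup G] (D : Set (SimpleGraph G)) : Prop :=
  ∀ C ∈ D, ∀ g : G, translate C g ∈ D

/-- No cycle of `D` shares more than one edge with a cycle of `D'`. -/
def Orthogonal {V : Type*} (D D' : Set (SimpleGraph V)) : Prop :=
  ∀ C ∈ D, ∀ C' ∈ D', (C.edgeSet ∩ C'.edgeSet).encard ≤ 1

end CycleDecomp

/-! Let `π` map ℤ/(2k+1)p onto ℤ/(2k+1). Its kernel is a copy `ι` of 𝔽_p, and its cosets are the
parts. Take a closed walk `x` whose k steps, with their negatives, run once through the nonzero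
residues mod 2k+1 (`exists_zmod_labelling`), and a closed polygon (A_j, B_j) over 𝔽_p with distinct
slopes c_j = ΔA_j/ΔB_j (`exists_polygon`). Move the vertices of `x` to x_j + ι(A_j a + B_j b) + g.
Edge j then has step Δx_j + ι(ΔB_j (c_j a + b)). For fixed a, as b varies, each difference outside
the kernel occurs once up to sign, so the translates by g decompose the graph. If a ≠ a', a common
edge of index j forces c_j a + b = c_j a' + b', which determines c_j and hence j. -/

/-! ### Base cycle with all differences modulo 2k+1 -/

/-- A closed walk on the integers whose steps have absolute values `1, …, k - 1` and `k` or `k + 1`. -/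
theorem exists_labelling (k : ℕ) (hk : 3 ≤ k) :
    ∃ (x : ℕ → ℤ) (l : ℕ → ℤ), x k = x 0 ∧ (∀ j < k, 0 ≤ x j ∧ x j ≤ k + 1) ∧
      (∀ i < k, ∀ j < k, x i = x j → i = j) ∧
      (∀ j < k, 0 < l j ∧ l j ≤ k + 1 ∧ (x (j + 1) - x j = l j ∨ x (j + 1) - x j = -l j)) ∧
      (∀ i < k, ∀ j < k, l i = l j → i = j) ∧
      (∀ i < k, ∀ j < k, l i + l j ≠ 2 * k + 1) := by
  -- The steps sum to 0, so the lengths have even sum. Lengths 1, …, k are thus possible only for k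
  -- ≡ 0, 3 mod 4; otherwise k + 1 replaces k.
  obtain ⟨m, h | h | h | h⟩ : ∃ m, k = 4 * m ∨ k = 4 * m + 1 ∨ k = 4 * m + 2 ∨ k = 4 * m + 3 :=
    ⟨k / 4, by omega⟩
  -- Zigzag 0, k, 1, k - 1, … with decreasing lengths. A shift halfway skips one length, which the
  -- closing edge supplies.
  · refine ⟨fun j => if j = k then 0 else if j % 2 = 0 then (j / 2 : ℕ) else
        if j ≤ 2 * m then k - (j / 2 : ℕ) else k - (j / 2 : ℕ) - 1,
      fun j => if j + 1 = k then 2 * m else if j + 1 ≤ 2 * m then k - j else k - j - 1,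
      ?_, ?_, ?_, ?_, ?_, ?_⟩ <;> dsimp only
    · grind
    · intro j hj; split_ifs <;> omega
    · intro i hi j hj; split_ifs <;> omega
    · intro j hj; split_ifs <;> omega
    · intro i hi j hj; split_ifs <;> omega
    · intro i hi j hj; split_ifs <;> omega
  -- Starting 0, k + 1, 2, k, …; the term `min j 1` makes the zigzag skip length k.
  · refine ⟨fun j => if j = k then 0 else if j % 2 = 0 then (j / 2 + min j 1 : ℕ) else
        if j ≤ 2 * m then k + 1 - (j / 2 : ℕ) else k - (j / 2 : ℕ),
      fun j => if j + 1 = k then 2 * m + 1 else if j = 0 then k + 1 else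
        if j + 1 ≤ 2 * m then k - j else k - j - 1,
      ?_, ?_, ?_, ?_, ?_, ?_⟩ <;> dsimp only
    · grind
    · intro j hj; split_ifs <;> omega
    · intro i hi j hj; split_ifs <;> omega
    · intro j hj; split_ifs <;> omega
    · intro i hi j hj; split_ifs <;> omega
    · intro i hi j hj; split_ifs <;> omega
  · refine ⟨fun j => if j = k then 0 else if j % 2 = 0 then (j / 2 + min j 1 : ℕ) else
        if j ≤ 2 * m then k + 1 - (j / 2 : ℕ) else k - (j / 2 : ℕ),
      fun j => if j + 1 = k then 2 * m + 2 else if j = 0 then k + 1 else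
        if j + 1 ≤ 2 * m then k - j else k - j - 1,
      ?_, ?_, ?_, ?_, ?_, ?_⟩ <;> dsimp only
    · grind
    · intro j hj; split_ifs <;> omega
    · intro i hi j hj; split_ifs <;> omega
    · intro j hj; split_ifs <;> omega
    · intro i hi j hj; split_ifs <;> omega
    · intro i hi j hj; split_ifs <;> omega
  · refine ⟨fun j => if j = k then 0 else if j % 2 = 1 then k - (j / 2 : ℕ) else
        if j ≤ 2 * m + 1 then (j / 2 : ℕ) else (j / 2 : ℕ) + 1,
      fun j => if j + 1 = k then 2 * m + 2 else if j ≤ 2 * m then k - j else k - j - 1,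
      ?_, ?_, ?_, ?_, ?_, ?_⟩ <;> dsimp only
    · grind
    · intro j hj; split_ifs <;> omega
    · intro i hi j hj; split_ifs <;> omega
    · intro j hj; split_ifs <;> omega
    · intro i hi j hj; split_ifs <;> omega
    · intro i hi j hj; split_ifs <;> omega

/-- The residues modulo `2 * k + 1` of a closed walk as in `exists_labelling`. -/
theorem exists_zmod_labelling (k : ℕ) (hk : 3 ≤ k) :
    ∃ x : ℕ → ℤ, x k = x 0 ∧
      (∀ i < k, ∀ j < k, (x i : ZMod (2 * k + 1)) = x j → i = j) ∧
      (∀ i < k, ∀ j < k, (x (i + 1) - x i : ZMod (2 * k + 1)) = x (j + 1) - x j → i = j) ∧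
      (∀ i < k, ∀ j < k, (x (i + 1) - x i : ZMod (2 * k + 1)) ≠ -(x (j + 1) - x j)) ∧
      (∀ r : ZMod (2 * k + 1), r ≠ 0 →
        ∃ j < k, r = x (j + 1) - x j ∨ r = -(x (j + 1) - x j)) := by
  obtain ⟨x, l, h0, hx, hinj, hl, hlinj, hsum⟩ := exists_labelling k hk
  have key : ∀ a : ℤ, (a : ZMod (2 * k + 1)) = 0 → a < 2 * (2 * k + 1) → -(2 * (2 * k + 1)) < a →
      a = 0 ∨ a = 2 * k + 1 ∨ a = -(2 * k + 1) := by
    intro a ha h1 h2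
    obtain ⟨q, hq⟩ := (ZMod.intCast_zmod_eq_zero_iff_dvd a (2 * k + 1)).1 (by exact_mod_cast ha)
    push_cast at hq
    have h3 : q < 2 := by nlinarith
    have h4 : -2 < q := by nlinarith
    obtain rfl | rfl | rfl : q = 0 ∨ q = 1 ∨ q = -1 := by omega
    all_goals grind
  have hd : ∀ i < k, ∀ j < k,
      (x (i + 1) - x i : ZMod (2 * k + 1)) = x (j + 1) - x j → i = j := by
    intro i hi j hj h
    have := key ((x (i + 1) - x i) - (x (j + 1) - x j)) (by push_cast; rw [h, sub_self])
    have := hl i hi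
    have := hl j hj
    have := hsum i hi j hj
    exact hlinj i hi j hj (by omega)
  have hs : ∀ i < k, ∀ j < k, (x (i + 1) - x i : ZMod (2 * k + 1)) ≠ -(x (j + 1) - x j) := by
    intro i hi j hj h
    have := key ((x (i + 1) - x i) + (x (j + 1) - x j)) (by push_cast; rw [h, neg_add_cancel])
    have := hl i hi
    have := hl j hj
    have := hsum i hi j hj
    have h1 : l i = l j := by omega
    obtain rfl := hlinj i hi j hj h1
    omega
  refine ⟨x, h0, ?_, hd, hs, ?_⟩
  · intro i hi j hj h
    have := key (x i - x j) (by push_cast; rw [h, sub_self])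
    have := hx i hi
    have := hx j hj
    exact hinj i hi j hj (by omega)
  · intro r hr
    -- The 2k signed steps are distinct and nonzero, so by counting they exhaust the nonzero
    -- residues.
    let f : Fin k ⊕ Fin k → ({0}ᶜ : Set (ZMod (2 * k + 1))) := Sum.elim
      (fun j => ⟨x (j + 1) - x j, fun h => hs j j.2 j j.2 (by
        rw [Set.mem_singleton_iff] at h; rw [h, neg_zero])⟩)
      (fun j => ⟨-(x (j + 1) - x j), fun h => hs j j.2 j j.2 (by
        rw [Set.mem_singleton_iff] at h; rw [h, ← neg_eq_zero, h])⟩)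
    have hf : Function.Injective f := by
      rintro (i | i) (j | j) h <;> replace h := congrArg Subtype.val h
      · exact congrArg _ (Fin.ext (hd i i.2 j j.2 h))
      · exact (hs i i.2 j j.2 h).elim
      · exact (hs j j.2 i i.2 h.symm).elim
      · exact congrArg _ (Fin.ext (hd i i.2 j j.2 (neg_injective h)))
    have hb := (Fintype.bijective_iff_injective_and_card f).2 ⟨hf, by
      rw [Fintype.card_compl_set, ZMod.card]; simp; omega⟩
    obtain ⟨j | j, hj⟩ := hb.2 ⟨r, hr⟩ <;> replace hj := congrArg Subtype.val hj
    · exact ⟨j, j.2, Or.inl hj.symm⟩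
    · exact ⟨j, j.2, Or.inr hj.symm⟩

/-! ### Polygons with distinct slopes -/

/-- A closed polygon in the plane over `ZMod p` whose edges have pairwise distinct finite slopes. -/
theorem exists_polygon (p : ℕ) [Fact p.Prime] (hp3 : 3 ≤ p) (k : ℕ) (hk : 3 ≤ k) (hkp : k ≤ p) :
    ∃ A B c : ℕ → ZMod p, A k = A 0 ∧ B k = B 0 ∧
      (∀ j < k, B (j + 1) - B j ≠ 0) ∧
      (∀ j < k, A (j + 1) - A j = c j * (B (j + 1) - B j)) ∧
      (∀ i < k, ∀ j < k, c i = c j → i = j) := by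
  have hp2 : ¬ 2 ∣ p := fun h => by
    have := (Nat.prime_dvd_prime_iff_eq Nat.prime_two (Fact.out : p.Prime)).1 h
    omega
  have key : ∀ a : ℤ, (a : ZMod p) = 0 → a < 2 * p → -(2 * p) < a →
      a = 0 ∨ a = p ∨ a = -p := by
    intro a ha h1 h2
    obtain ⟨q, hq⟩ := (ZMod.intCast_zmod_eq_zero_iff_dvd a p).1 ha
    have h3 : q < 2 := by nlinarith
    have h4 : -2 < q := by nlinarith
    obtain rfl | rfl | rfl : q = 0 ∨ q = 1 ∨ q = -1 := by omega
    all_goals grind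
  have h1 : (1 : ZMod p) ≠ 0 := one_ne_zero
  obtain ⟨m, rfl | rfl⟩ : ∃ m, k = 2 * m ∨ k = 2 * m + 1 := ⟨k / 2, by omega⟩
  · have hm : (m - 1 : ZMod p) ≠ 0 := fun h => by
      have := key (m - 1) (by push_cast; exact h)
      omega
    -- Slopes 1, -1, 2, -2, …, m, -m. Unit steps in B cancel in pairs up to (0, 2m - 2); the last
    -- two edges return to the origin with B-steps -(m - 1). As p is odd, 2m < p keeps the slopes
    -- distinct.
    refine ⟨fun j => if j + 1 = 2 * m then -((m - 1) * m) else
        if j % 2 = 0 then 0 else ((j / 2 : ℕ) : ZMod p) + 1,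
      fun j => if j + 1 = 2 * m then m - 1 else if j = 2 * m then 0 else j,
      fun j => (((if j % 2 = 0 then (j / 2 : ℕ) + 1 else -((j / 2 : ℕ) + 1)) : ℤ) : ZMod p),
      ?_, ?_, ?_, ?_, ?_⟩ <;> dsimp only
    · grind
    · grind
    · intro j hj
      obtain h | h | h : j + 1 = 2 * m ∨ j + 2 = 2 * m ∨ j + 2 < 2 * m := by omega
      · rw [if_neg (by omega), if_pos h, if_pos h, zero_sub]
        exact neg_ne_zero.2 hm
      · rw [if_pos (by omega), if_neg (by omega), if_neg (by omega)]
        have h' : (j : ZMod p) + 2 = 2 * m := by exact_mod_cast congrArg (Nat.cast (R := ZMod p)) h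
        rw [show (m - 1 - j : ZMod p) = -(m - 1) by linear_combination -h']
        exact neg_ne_zero.2 hm
      · rw [if_neg (by omega), if_neg (by omega), if_neg (by omega), if_neg (by omega)]
        push_cast
        rwa [add_sub_cancel_left]
    · intro j hj
      obtain h | h | h : j + 1 = 2 * m ∨ j + 2 = 2 * m ∨ j + 2 < 2 * m := by omega
      · have h' : ((j / 2 : ℕ) : ZMod p) + 1 = m := by
          exact_mod_cast congrArg (Nat.cast (R := ZMod p)) (show j / 2 + 1 = m by omega)
        simp only [if_neg (show ¬j + 1 + 1 = 2 * m by omega), if_pos (show (j + 1) % 2 = 0 by omega),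
          if_pos h, if_neg (show ¬j % 2 = 0 by omega), Int.cast_neg, Int.cast_add, Int.cast_natCast,
          Int.cast_one]
        linear_combination (1 - (m : ZMod p)) * h'
      · have h' : ((j / 2 : ℕ) : ZMod p) + 1 = m := by
          exact_mod_cast congrArg (Nat.cast (R := ZMod p)) (show j / 2 + 1 = m by omega)
        have h'' : (j : ZMod p) + 2 = 2 * m := by exact_mod_cast congrArg (Nat.cast (R := ZMod p)) h
        simp only [if_pos (show j + 1 + 1 = 2 * m by omega), if_pos (show j % 2 = 0 by omega),
          if_neg (show ¬j + 1 = 2 * m by omega), if_neg (show ¬j = 2 * m by omega), Int.cast_add,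
          Int.cast_natCast, Int.cast_one]
        linear_combination (m : ZMod p) * h'' - (m - 1 - j : ZMod p) * h'
      · simp only [if_neg (show ¬j + 1 + 1 = 2 * m by omega),
          if_neg (show ¬j + 1 = 2 * m by omega), if_neg (show ¬j = 2 * m by omega), Nat.cast_add,
          Nat.cast_one, add_sub_cancel_left, mul_one]
        obtain h2 | h2 : j % 2 = 0 ∨ j % 2 = 1 := by omega
        · simp [h2, show (j + 1) % 2 = 1 by omega, show (j + 1) / 2 = j / 2 by omega,
            -Nat.cast_div, -Int.natCast_ediv]
        · simp [h2, show (j + 1) % 2 = 0 by omega, -Nat.cast_div, -Int.natCast_ediv]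
    · intro i hi j hj h
      have := key _ (by rw [Int.cast_sub]; exact sub_eq_zero.2 h)
      split_ifs at this <;> omega
  -- Points (j², j) on a parabola: a chord has slope the sum of its parameters, so 2j + 1, and 2m
  -- for the closing chord.
  · refine ⟨fun j => if j = 2 * m + 1 then 0 else (j : ZMod p) ^ 2,
      fun j => if j = 2 * m + 1 then 0 else j,
      fun j => (((if j = 2 * m then 2 * m else 2 * j + 1) : ℤ) : ZMod p),
      ?_, ?_, ?_, ?_, ?_⟩ <;> dsimp only
    · grind
    · grind
    · intro j hj
      obtain rfl | h : j = 2 * m ∨ j < 2 * m := by omega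
      · rw [if_pos rfl, if_neg (by omega), zero_sub, neg_ne_zero]
        intro h
        have := key (2 * m : ℕ) (by rw [Int.cast_natCast]; exact h)
        omega
      · rw [if_neg (by omega), if_neg (by omega)]
        push_cast
        rwa [add_sub_cancel_left]
    · intro j hj
      obtain rfl | h : j = 2 * m ∨ j < 2 * m := by omega
      · rw [if_pos rfl, if_neg (by omega), if_pos rfl, if_pos rfl, if_neg (by omega)]
        push_cast
        ring
      · rw [if_neg (by omega), if_neg (by omega), if_neg (by omega), if_neg (by omega),
          if_neg (by omega)]
        push_cast
        ring
    · intro i hi j hj h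
      have := key _ (by rw [Int.cast_sub]; exact sub_eq_zero.2 h)
      split_ifs at this <;> omega

/-! ### Closed walks as graphs -/

namespace CycleDecomp

open SimpleGraph

/-- The closed walk through `V 0, …, V (k - 1), V k`, as a graph. -/
def walkGraph {G : Type*} (k : ℕ) (V : ℕ → G) : SimpleGraph G :=
  (cycleGraph k).map fun i : Fin k => V i

theorem cycleGraph_adj_iff {k : ℕ} (hk : 3 ≤ k) (i j : Fin k) :
    (cycleGraph k).Adj i j ↔
      (j.val = if i.val + 1 = k then 0 else i.val + 1) ∨
      (i.val = if j.val + 1 = k then 0 else j.val + 1) := by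
  obtain ⟨n, rfl⟩ : ∃ n, k = n + 3 := ⟨k - 3, by omega⟩
  rw [cycleGraph_adj, sub_eq_iff_eq_add, sub_eq_iff_eq_add, add_comm 1 j, add_comm 1 i, or_comm]
  simp only [Fin.ext_iff, Fin.val_add_eq_ite, Fin.val_one]
  have := i.2
  have := j.2
  grind

/-- Indexing by ℕ with `V k = V 0` replaces cyclic arithmetic in `Fin k`. -/
theorem walkGraph_adj {G : Type*} {k : ℕ} (hk : 3 ≤ k) {V : ℕ → G}
    (hV : ∀ i < k, ∀ j < k, V i = V j → i = j) (h0 : V k = V 0) (u v : G) :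
    (walkGraph k V).Adj u v ↔
      ∃ j < k, (V j = u ∧ V (j + 1) = v) ∨ (V j = v ∧ V (j + 1) = u) := by
  have hnext : ∀ j < k, V (if j + 1 = k then 0 else j + 1) = V (j + 1) := by
    intro j hj
    split_ifs with h
    · rw [h, h0]
    · rfl
  have hinj : Function.Injective fun i : Fin k => V i := fun i j h =>
    Fin.ext (hV i i.2 j j.2 h)
  rw [walkGraph, map_adj']
  constructor
  · rintro ⟨-, i, j, hij, rfl, rfl⟩
    obtain h | h := (cycleGraph_adj_iff hk i j).1 hij
    · exact ⟨i, i.2, Or.inl ⟨rfl, by rw [h, hnext i i.2]⟩⟩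
    · exact ⟨j, j.2, Or.inr ⟨rfl, by rw [h, hnext j j.2]⟩⟩
  · rintro ⟨j, hj, h⟩
    let a : Fin k := ⟨j, hj⟩
    let b : Fin k := ⟨if j + 1 = k then 0 else j + 1, by split_ifs <;> omega⟩
    have hab : (cycleGraph k).Adj a b := (cycleGraph_adj_iff hk a b).2 (Or.inl rfl)
    have hb : V b = V (j + 1) := hnext j hj
    obtain ⟨rfl, rfl⟩ | ⟨rfl, rfl⟩ := h
    · exact ⟨fun h => hab.ne (hinj (h.trans hb.symm)), a, b, hab, rfl, hb⟩
    · exact ⟨fun h => hab.ne (hinj (h.symm.trans hb.symm)), b, a, hab.symm, hb, rfl⟩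

theorem translate_walkGraph {G : Type*} [AddGroup G] (k : ℕ) (V : ℕ → G) (g : G) :
    translate (walkGraph k V) g = walkGraph k fun j => V j + g := by
  ext u v
  simp only [translate, walkGraph, map_adj']
  constructor
  · rintro ⟨hne, _, _, ⟨-, i, j, hij, rfl, rfl⟩, rfl, rfl⟩
    exact ⟨hne, i, j, hij, rfl, rfl⟩
  · rintro ⟨hne, i, j, hij, rfl, rfl⟩
    exact ⟨hne, _, _, ⟨fun h => hne (congrArg (· + g) h), i, j, hij, rfl, rfl⟩, rfl, rfl⟩

/-! ### Decompositions from polygon data -/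

/-- A closed walk `x` in `G` whose image in `Q` is a cycle with the steps `δ` such that every
nonzero element of `Q` is exactly once of the form `δ` or `-δ`, together with a closed polygon in
the plane over `F`, a copy of which is the kernel of `π : G → Q`, with distinct finite slopes. -/
structure PolygonData (G Q F : Type*) [AddCommGroup G] [AddCommGroup Q] [Field F] (k : ℕ) where
  three_le : 3 ≤ k
  π : G →+ Q
  ι : F →+ G
  ι_injective : Function.Injective ι
  π_ι : ∀ y, π (ι y) = 0
  exists_ι : ∀ u, π u = 0 → ∃ y, ι y = u
  x : ℕ → G
  x_closed : x k = x 0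
  x_inj : ∀ i < k, ∀ j < k, π (x i) = π (x j) → i = j
  step_inj : ∀ i < k, ∀ j < k, π (x (i + 1)) - π (x i) = π (x (j + 1)) - π (x j) → i = j
  step_ne_neg : ∀ i < k, ∀ j < k, π (x (i + 1)) - π (x i) ≠ -(π (x (j + 1)) - π (x j))
  step_surj : ∀ r : Q, r ≠ 0 →
    ∃ j < k, r = π (x (j + 1)) - π (x j) ∨ r = -(π (x (j + 1)) - π (x j))
  A : ℕ → F
  B : ℕ → F
  slope : ℕ → F
  A_closed : A k = A 0
  B_closed : B k = B 0
  B_step : ∀ j < k, B (j + 1) - B j ≠ 0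
  A_step : ∀ j < k, A (j + 1) - A j = slope j * (B (j + 1) - B j)
  slope_inj : ∀ i < k, ∀ j < k, slope i = slope j → i = j

namespace PolygonData

variable {G Q F : Type*} [AddCommGroup G] [AddCommGroup Q] [Field F] {k : ℕ}
  (P : PolygonData G Q F k)

/-- The vertices of the cycle with parameters `a`, `b`, `g`. -/
def vertex (a b : F) (g : G) (j : ℕ) : G := P.x j + P.ι (P.A j * a + P.B j * b) + g

/-- The translates of the base cycles belonging to `a`. -/
def cycles (a : F) : Set (SimpleGraph G) :=
  {C | ∃ b g, C = walkGraph k (P.vertex a b g)}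

/-- The complete multipartite graph whose parts are the cosets of the kernel of `π`. -/
def host : SimpleGraph G := SimpleGraph.comap P.π ⊤

theorem π_vertex (a b : F) (g : G) (j : ℕ) : P.π (P.vertex a b g j) = P.π (P.x j) + P.π g := by
  simp [vertex, P.π_ι]

theorem vertex_inj (a b : F) (g : G) :
    ∀ i < k, ∀ j < k, P.vertex a b g i = P.vertex a b g j → i = j := fun i hi j hj h =>
  P.x_inj i hi j hj (by simpa [π_vertex] using congrArg P.π h)

theorem vertex_closed (a b : F) (g : G) : P.vertex a b g k = P.vertex a b g 0 := by
  simp only [vertex, P.x_closed, P.A_closed, P.B_closed]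

theorem adj_iff (a b : F) (g : G) (u v : G) :
    (walkGraph k (P.vertex a b g)).Adj u v ↔
      ∃ j < k, (P.vertex a b g j = u ∧ P.vertex a b g (j + 1) = v) ∨
        (P.vertex a b g j = v ∧ P.vertex a b g (j + 1) = u) :=
  walkGraph_adj P.three_le (P.vertex_inj a b g) (P.vertex_closed a b g) u v

theorem π_vertex_sub (a b : F) (g : G) (j : ℕ) :
    P.π (P.vertex a b g (j + 1)) - P.π (P.vertex a b g j) = P.π (P.x (j + 1)) - P.π (P.x j) := by
  rw [π_vertex, π_vertex, add_sub_add_right_eq_sub]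

theorem vertex_sub (a b : F) (g : G) {j : ℕ} (hj : j < k) :
    P.vertex a b g (j + 1) - P.vertex a b g j =
      P.x (j + 1) - P.x j + P.ι ((P.B (j + 1) - P.B j) * (P.slope j * a + b)) := by
  have : (P.B (j + 1) - P.B j) * (P.slope j * a + b) =
      (P.A (j + 1) * a + P.B (j + 1) * b) - (P.A j * a + P.B j * b) := by
    linear_combination -a * P.A_step j hj
  rw [this, map_sub, vertex, vertex]
  abel

/-- An edge common to two cycles is the edge with the same index in both of them. -/
theorem index_of_common_edge {a b a' b' : F} {g g' u v : G}
    (h : (walkGraph k (P.vertex a b g)).Adj u v) (h' : (walkGraph k (P.vertex a' b' g')).Adj u v) :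
    ∃ j < k, s(u, v) = s(P.vertex a b g j, P.vertex a b g (j + 1)) ∧
      P.slope j * a + b = P.slope j * a' + b' ∧ P.vertex a b g j = P.vertex a' b' g' j := by
  have key : ∀ i < k, ∀ j < k, P.vertex a b g i = P.vertex a' b' g' j →
      P.vertex a b g (i + 1) = P.vertex a' b' g' (j + 1) →
      i = j ∧ P.slope i * a + b = P.slope i * a' + b' := by
    intro i hi j hj h1 h2
    have hij : i = j := P.step_inj i hi j hj (by
      rw [← P.π_vertex_sub a b g, ← P.π_vertex_sub a' b' g', h1, h2])
    subst hij
    refine ⟨rfl, ?_⟩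
    have := P.vertex_sub a b g hi
    rw [h1, h2, P.vertex_sub a' b' g' hi, add_right_inj] at this
    exact (mul_left_cancel₀ (P.B_step i hi) (P.ι_injective this)).symm
  -- No step modulo the kernel is the negative of a step, so a common edge is traversed in the same
  -- direction.
  have anti : ∀ i < k, ∀ j < k, P.vertex a b g i = P.vertex a' b' g' (j + 1) →
      P.vertex a b g (i + 1) ≠ P.vertex a' b' g' j := by
    intro i hi j hj h1 h2
    apply P.step_ne_neg i hi j hj
    rw [← P.π_vertex_sub a b g, ← P.π_vertex_sub a' b' g', h1, h2, neg_sub]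
  obtain ⟨i, hi, hu⟩ := (P.adj_iff a b g u v).1 h
  obtain ⟨j, hj, hv⟩ := (P.adj_iff a' b' g' u v).1 h'
  refine ⟨i, hi, ?_⟩
  obtain ⟨rfl, rfl⟩ | ⟨rfl, rfl⟩ := hu <;> obtain ⟨h1, h2⟩ | ⟨h1, h2⟩ := hv
  · obtain ⟨rfl, h3⟩ := key i hi j hj h1.symm h2.symm
    exact ⟨rfl, h3, h1.symm⟩
  · exact (anti i hi j hj h2.symm h1.symm).elim
  · exact (anti i hi j hj h2.symm h1.symm).elim
  · obtain ⟨rfl, h3⟩ := key i hi j hj h1.symm h2.symm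
    exact ⟨Sym2.eq_swap, h3, h1.symm⟩

/-- With a fixed, a common edge determines b from c_j a + b, then g from its initial vertex. -/
theorem isKCycleDecomposition (a : F) : IsKCycleDecomposition k P.host (P.cycles a) where
  isKCycle := by
    rintro _ ⟨b, g, rfl⟩
    exact ⟨_, fun i j h => Fin.ext (P.vertex_inj a b g i i.2 j j.2 h), rfl⟩
  pairwiseDisjoint := by
    rintro _ ⟨b, g, rfl⟩ _ ⟨b', g', rfl⟩ hne
    refine Set.disjoint_left.2 fun e he he' => hne ?_
    induction e with | _ u v
    obtain ⟨j, -, -, h1, h2⟩ := P.index_of_common_edge he he'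
    obtain rfl := add_left_cancel h1
    obtain rfl := add_left_cancel h2
    rfl
  iUnion_edgeSet := by
    ext e
    induction e with | _ u v
    simp only [Set.mem_iUnion, mem_edgeSet, exists_prop, host, comap_adj, top_adj]
    constructor
    · rintro ⟨_, ⟨b, g, rfl⟩, h⟩ heq
      obtain ⟨j, hj, h⟩ := (P.adj_iff a b g u v).1 h
      have h1 := P.π_vertex_sub a b g j
      have h2 : P.π (P.x (j + 1)) - P.π (P.x j) = 0 := by
        obtain ⟨rfl, rfl⟩ | ⟨rfl, rfl⟩ := h <;> rw [← h1, heq, sub_self]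
      exact P.step_ne_neg j hj j hj (by rw [h2, neg_zero])
    · have key : ∀ u v, ∀ j < k, P.π v - P.π u = P.π (P.x (j + 1)) - P.π (P.x j) →
          ∃ b g, P.vertex a b g j = u ∧ P.vertex a b g (j + 1) = v := by
        intro u v j hj h
        obtain ⟨y, hy⟩ := P.exists_ι ((v - u) - (P.x (j + 1) - P.x j)) (by
          rw [map_sub, map_sub, map_sub, h, sub_self])
        -- Solves ΔB_j (c_j a + b) = y.
        let b := (P.B (j + 1) - P.B j)⁻¹ * y - P.slope j * a
        let g := u - P.vertex a b 0 j
        have hu : P.vertex a b g j = u := by simp [g, vertex]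
        refine ⟨b, g, hu, ?_⟩
        have h3 := P.vertex_sub a b g hj
        have h4 : (P.B (j + 1) - P.B j) * (P.slope j * a + b) = y := by
          simp only [b]
          rw [add_sub_cancel, mul_inv_cancel_left₀ (P.B_step j hj)]
        rw [h4, hy, add_sub_cancel, hu] at h3
        exact sub_left_injective h3
      intro hne
      obtain ⟨j, hj, h | h⟩ := P.step_surj (P.π v - P.π u) (sub_ne_zero.2 (Ne.symm hne))
      · obtain ⟨b, g, h1, h2⟩ := key u v j hj h
        exact ⟨_, ⟨b, g, rfl⟩, (P.adj_iff a b g u v).2 ⟨j, hj, Or.inl ⟨h1, h2⟩⟩⟩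
      · obtain ⟨b, g, h1, h2⟩ := key v u j hj (by rw [← neg_sub, h, neg_neg])
        exact ⟨_, ⟨b, g, rfl⟩, (P.adj_iff a b g u v).2 ⟨j, hj, Or.inr ⟨h1, h2⟩⟩⟩

theorem isRegular (a : F) : IsRegular (P.cycles a) := by
  rintro _ ⟨b, g, rfl⟩ t
  refine ⟨b, g + t, ?_⟩
  rw [translate_walkGraph]
  congr 1
  funext j
  exact add_assoc _ _ _

theorem index_unique {a a' b b' : F} (h : a ≠ a') {i j : ℕ} (hi : i < k) (hj : j < k)
    (h1 : P.slope i * a + b = P.slope i * a' + b')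
    (h2 : P.slope j * a + b = P.slope j * a' + b') : i = j :=
  P.slope_inj i hi j hj (mul_right_cancel₀ (sub_ne_zero.2 h) (by linear_combination h1 - h2))

theorem orthogonal {a a' : F} (h : a ≠ a') : Orthogonal (P.cycles a) (P.cycles a') := by
  rintro _ ⟨b, g, rfl⟩ _ ⟨b', g', rfl⟩
  refine Set.encard_le_one_iff.2 ?_
  rintro e f ⟨he, he'⟩ ⟨hf, hf'⟩
  induction e with | _ u v
  induction f with | _ u' v'
  obtain ⟨i, hi, h1, h2, -⟩ := P.index_of_common_edge he he'
  obtain ⟨j, hj, h3, h4, -⟩ := P.index_of_common_edge hf hf'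
  obtain rfl := P.index_unique h hi hj h2 h4
  rw [h1, h3]

/-- For a ≠ a', a cycle in both families would share its edges 0 and 1 with itself, against
`index_unique`. -/
theorem cycles_injective : Function.Injective P.cycles := by
  intro a a' h
  by_contra hne
  obtain ⟨b', g', h'⟩ : walkGraph k (P.vertex a 0 0) ∈ P.cycles a' := h ▸ ⟨0, 0, rfl⟩
  have hk := P.three_le
  have key : ∀ j < k, P.slope j * a + 0 = P.slope j * a' + b' := by
    intro j hj
    have hadj := (P.adj_iff a 0 0 _ _).2 ⟨j, hj, Or.inl ⟨rfl, rfl⟩⟩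
    obtain ⟨i, hi, h1, h2, -⟩ := P.index_of_common_edge hadj (h' ▸ hadj)
    have hij : j = i := by
      obtain ⟨h3, h4⟩ | ⟨h3, h4⟩ := Sym2.eq_iff.1 h1
      · exact P.vertex_inj a 0 0 j hj i hi h3
      · refine (P.step_ne_neg j hj i hi ?_).elim
        rw [← P.π_vertex_sub a 0 0, ← P.π_vertex_sub a 0 0, h3, h4, neg_sub]
    rwa [hij]
  exact absurd (P.index_unique hne (by omega : 0 < k) (by omega : 1 < k) (key 0 (by omega))
    (key 1 (by omega))) zero_ne_one

end PolygonData

end CycleDecomp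

/-! ### Realization over ℤ/(2k+1)p -/

theorem exists_polygonData (p : ℕ) [Fact p.Prime] (hp3 : 3 ≤ p) (k : ℕ) (hk : 3 ≤ k)
    (hkp : k ≤ p) : ∃ P : CycleDecomp.PolygonData (ZMod ((2 * k + 1) * p)) (ZMod (2 * k + 1))
      (ZMod p) k, Function.Surjective P.π := by
  obtain ⟨x, x0, x1, x2, x3, x4⟩ := exists_zmod_labelling k hk
  obtain ⟨A, B, c, A0, B0, B1, A1, c1⟩ := exists_polygon p hp3 k hk hkp
  let N := 2 * k + 1
  let π : ZMod (N * p) →+ ZMod N := (ZMod.castHom (dvd_mul_right N p) (ZMod N)).toAddMonoidHom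
  have hπ : ∀ a : ℤ, π a = a := fun a => map_intCast (ZMod.castHom (dvd_mul_right N p) (ZMod N)) a
  -- The kernel embedding is y ↦ Ny. The extension need not split: p may divide N.
  let f : {f : ℤ →+ ZMod (N * p) // f p = 0} :=
    ⟨(AddMonoidHom.mulLeft (N : ZMod (N * p))).comp (Int.castAddHom _), by
      simp only [AddMonoidHom.comp_apply, Int.coe_castAddHom, AddMonoidHom.coe_mulLeft,
        Int.cast_natCast]
      exact_mod_cast ZMod.natCast_self (N * p)⟩
  have hf : ∀ m : ℤ, ZMod.lift p f m = ((N * m : ℤ) : ZMod (N * p)) := by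
    intro m
    rw [ZMod.lift_coe]
    simp [f]
  have hN : (N : ℤ) ≠ 0 := by simp [N]; omega
  refine ⟨⟨hk, π, ZMod.lift p f, ?_, ?_, ?_, fun j => (x j : ZMod (N * p)), by rw [x0], ?_, ?_, ?_,
    ?_, A, B, c, A0, B0, B1, A1, c1⟩, ?_⟩
  · rw [ZMod.lift_injective]
    intro m hm
    rw [← ZMod.lift_coe, hf, ZMod.intCast_zmod_eq_zero_iff_dvd, Nat.cast_mul] at hm
    exact (ZMod.intCast_zmod_eq_zero_iff_dvd _ _).2 (Int.dvd_of_mul_dvd_mul_left hN hm)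
  · intro y
    obtain ⟨m, rfl⟩ := ZMod.intCast_surjective y
    rw [hf, hπ, ZMod.intCast_zmod_eq_zero_iff_dvd]
    exact dvd_mul_right _ _
  · intro u hu
    obtain ⟨m, rfl⟩ := ZMod.intCast_surjective u
    rw [hπ, ZMod.intCast_zmod_eq_zero_iff_dvd] at hu
    obtain ⟨q, rfl⟩ := hu
    exact ⟨q, hf q⟩
  · simpa only [hπ] using x1
  · simpa only [hπ] using x2
  · simpa only [hπ] using x3
  · simpa only [hπ] using x4
  · exact ZMod.castHom_surjective (dvd_mul_right N p)

namespace CycleDecomp.PolygonData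

/-- A set-theoretic section of `π` suffices to identify G with Q × F, as adjacency depends only on
`π`. -/
theorem nonempty_iso_completeEquipartiteGraph {G Q F : Type*} [AddCommGroup G] [AddCommGroup Q]
    [Field F] {k : ℕ} (P : PolygonData G Q F k) (hπ : Function.Surjective P.π) {r t : ℕ}
    (eQ : Q ≃ Fin r) (eF : F ≃ Fin t) :
    Nonempty (P.host ≃g SimpleGraph.completeEquipartiteGraph r t) := by
  obtain ⟨s, hs⟩ := hπ.hasRightInverse
  let e : Q × F → G := fun y => s y.1 + P.ι y.2
  have he : ∀ y, P.π (e y) = y.1 := fun y => by simp [e, P.π_ι, hs y.1]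
  have hb : Function.Bijective e := by
    constructor
    · intro y z h
      have h1 : y.1 = z.1 := by rw [← he y, ← he z, h]
      refine Prod.ext h1 (P.ι_injective ?_)
      simpa only [e, h1, add_right_inj] using h
    · intro u
      obtain ⟨y, hy⟩ := P.exists_ι (u - s (P.π u)) (by rw [map_sub, hs, sub_self])
      exact ⟨(P.π u, y), by simp only [e, hy, add_sub_cancel]⟩
  let E := Equiv.ofBijective e hb
  have hE : ∀ u, (E.symm u).1 = P.π u := fun u => by
    rw [← he]
    exact congrArg P.π (E.apply_symm_apply u)
  refine ⟨⟨E.symm.trans (eQ.prodCongr eF), ?_⟩⟩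
  intro u v
  simp [host, hE]

end CycleDecomp.PolygonData

theorem theorem5p4 (p : ℕ) (hp : p.Prime) (hp3 : 3 ≤ p) (k : ℕ) (hk : k ∈ Set.Icc 3 p) :
    ∃ K : SimpleGraph (ZMod ((2 * k + 1) * p)),
      Nonempty (K ≃g SimpleGraph.completeEquipartiteGraph (2 * k + 1) p) ∧
      ∃ D : Fin p → Set (SimpleGraph (ZMod ((2 * k + 1) * p))),
        Function.Injective D ∧
        (∀ i, CycleDecomp.IsKCycleDecomposition k K (D i) ∧ CycleDecomp.IsRegular (D i)) ∧
        Pairwise fun i j => CycleDecomp.Orthogonal (D i) (D j) := by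
  have : Fact p.Prime := ⟨hp⟩
  obtain ⟨P, hP⟩ := exists_polygonData p hp3 k hk.1 hk.2
  have eQ := Fintype.equivFinOfCardEq (ZMod.card (2 * k + 1))
  have eF := Fintype.equivFinOfCardEq (ZMod.card p)
  refine ⟨P.host, P.nonempty_iso_completeEquipartiteGraph hP eQ eF, fun i => P.cycles (eF.symm i),
    P.cycles_injective.comp eF.symm.injective,
    fun i => ⟨P.isKCycleDecomposition _, P.isRegular _⟩,
    fun i j hij => P.orthogonal (eF.symm.injective.ne hij)⟩
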